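/- \textbf{Setting.} Let $A$ be a free group with a finite free basis $a_1,\dots,a_n$, let $T$ be the Cayley graph of $A$ with respect to this basis (a simplicial tree with vertex set $A$ and edges of length $1$), let $B$ be a group and $\varphi\colon A\to\operatorname{Aut}(B)$ a homomorphism such that $G=B\rtimes_\varphi A$ is finitely generated. Let $\rho$ be the action of $G$ on $T$ by isometries induced by the projection $G\to A$ and the action of $A$ on $T$ by left translations. For a geodesic ray $\tau\colon[0,\infty)\to T$ and $t\in\mathbb R$ let $HB_t(\tau)=\bigcup_{l\ge\max\{0,t\}}\{x\in T: d(x,\tau(l))\le l-t\}$. Let $\tilde X$ be the universal cover of a $K(G,1)$-complex (i.e. a contractible free $G$-CW-complex) with cocompact $1$-skeleton $\tilde X^{(1)}$, let $h\colon\tilde X^{(1)}\to T$ be a continuous $G$-map, and let $\tilde X_{(\tau,t)}$ be the largest subcomplex of $\tilde X^{(1)}$ contained in $h^{-1}(HB_t(\tau))$. The map $h$ is \emph{controlled connected over} the endpoint $\tau(\infty)\in\partial T$ if there is $\lambda\colon\mathbb R\to[0,\infty)$ with $t-\lambda(t)\to\infty$ as $t\to\infty$ such that for every $t\in\mathbb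 R$ any two points of $\tilde X_{(\tau,t)}$ can be joined by a path in $\tilde X_{(\tau,t-\lambda(t))}$. The boundary $\partial T$ is the set of geodesic rays up to bounded distance, and $\Sigma^1(\rho)$ is the set of all $e\in\partial T$ such that every such $h$ (for every choice of $\tilde X$) is controlled connected over $e=\tau(\infty)$, for every ray $\tau$ representing $e$. (This property is in fact independent of these choices.) An infinite freely reduced word $c_1c_2c_3\cdots$ in the letters $a_1^{\pm1},\dots,a_n^{\pm1}$ represents the endpoint $e=\tau(\infty)$ of the geodesic ray $\tau$ in $T$ with $\tau(m)=c_1c_2\cdots c_m$ for all $m\ge 0$. \textbf{Theorem.} Let $e\in\partial T$ be represented by an infinite freely reduced word $c_1c_2c_3\cdots$ that contains infinitely many mutually distinct nonempty subwords lying in $\ker\varphi$, where subwords are distinguished by their position; that is, there are infinitely many pairs $i<j$ of integers $\geq 0$ with $c_{i+1}c_{i+2}\cdots c_j\in\ker\varphi$. Then $e\in\Sigma^1(\rho)$. -/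

import Mathlib

open scoped ENNReal NNReal
open Topology Filter

universe u₁ u₂ u₃ u₄

/-! ### Geodesic rays, the boundary, horoballs -/

/-- A geodesic ray in a metric space: an isometric embedding of `[0, ∞)`. -/
structure GeodesicRay (M : Type*) [MetricSpace M] where
  /-- The underlying map. -/
  toFun : ℝ≥0 → M
  /-- The map preserves distances. -/
  isometry : Isometry toFun

namespace GeodesicRay

variable {M : Type*} [MetricSpace M]

/-- Two rays are asymptotic if they stay at bounded distance from each other. -/
def asymptotic (M : Type*) [MetricSpace M] : Setoid (GeodesicRay M) where
  r τ τ' := ∃ D : ℝ, ∀ l : ℝ≥0, dist (τ.toFun l) (τ'.toFun l) ≤ D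
  iseqv :=
    { refl := fun τ => ⟨0, fun l => by simp⟩
      symm := fun ⟨D, h⟩ => ⟨D, fun l => by rw [dist_comm]; exact h l⟩
      trans := fun ⟨D, h⟩ ⟨D', h'⟩ =>
        ⟨D + D', fun l => (dist_triangle _ _ _).trans (add_le_add (h l) (h' l))⟩ }

/-- The horoball `HB_t(τ)`: the increasing union, over `l ≥ max 0 t`, of the closed balls of radius
`l - t` about `τ l`. It shrinks towards the end of `τ` as `t` increases. -/
def horoball (τ : GeodesicRay M) (t : ℝ) : Set M :=
  ⋃ (l : ℝ≥0) (_ : t ≤ (l : ℝ)), Metric.closedBall (τ.toFun l) ((l : ℝ) - t)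

end GeodesicRay

/-- The boundary `∂M`: geodesic rays up to bounded distance. -/
def Boundary (M : Type*) [MetricSpace M] : Type _ := Quotient (GeodesicRay.asymptotic M)

/-- The point `τ(∞)` of the boundary represented by the ray `τ`. -/
def GeodesicRay.endpoint {M : Type*} [MetricSpace M] (τ : GeodesicRay M) : Boundary M :=
  Quotient.mk (GeodesicRay.asymptotic M) τ

/-! ### Controlled connectivity and `Σ¹` -/

section ControlledConnectivity

/-- `X` is a free `G`-CW-complex: `G` acts by homeomorphisms that permute the open cells, and
no nontrivial element maps an open cell to itself. -/
structure IsFreeGCW (G : Type*) [Group G] (X : Type*) [TopologicalSpace X] [T2Space X]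
    [CWComplex (Set.univ : Set X)] [MulAction G X] : Prop where
  continuous_smul : ∀ g : G, Continuous fun x : X => g • x
  permutes : ∀ (g : G) (n : ℕ) (i : RelCWComplex.cell (Set.univ : Set X) n),
    ∃ j : RelCWComplex.cell (Set.univ : Set X) n,
      (fun x : X => g • x) '' RelCWComplex.openCell n i = RelCWComplex.openCell n j
  free : ∀ (g : G) (n : ℕ) (i : RelCWComplex.cell (Set.univ : Set X) n),
    (fun x : X => g • x) '' RelCWComplex.openCell n i = RelCWComplex.openCell n i → g = 1

/-- The `1`-skeleton of the CW complex `X`, as a set of points. -/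
def oneSkeleton (X : Type*) [TopologicalSpace X] [T2Space X]
    [CWComplex (Set.univ : Set X)] : Set X :=
  (CWComplex.skeleton (Set.univ : Set X) 1 : Set X)

/-- The `G`-space `Y ⊆ X` is cocompact: it is the `G`-orbit of a compact set. -/
def IsCocompactSubset (G : Type*) {X : Type*} [Group G] [TopologicalSpace X] [MulAction G X]
    (Y : Set X) : Prop :=
  ∃ K : Set X, IsCompact K ∧ Y = ⋃ g : G, (fun x : X => g • x) '' K

/-- `X_(τ,t)`: the largest subcomplex of the `1`-skeleton of `X` contained in the preimage under `h`
of the horoball `HB_t(τ)`, i.e. the union of all such subcomplexes. -/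
def horoSubcomplex {X : Type*} [TopologicalSpace X] [T2Space X] [CWComplex (Set.univ : Set X)]
    {M : Type*} [MetricSpace M] (h : X → M) (τ : GeodesicRay M) (t : ℝ) : Set X :=
  ⋃ (E : RelCWComplex.Subcomplex (Set.univ : Set X))
    (_ : (E : Set X) ⊆ oneSkeleton X ∧ (E : Set X) ⊆ h ⁻¹' τ.horoball t), (E : Set X)

/-- The control map `h` is controlled connected over `τ(∞)`: there is a lag `lag : ℝ → [0, ∞)` with
`t - lag t → ∞` as `t → ∞` such that any two points of `X_(τ,t)` can be joined by a path in
`X_(τ,t - lag t)`. -/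
def IsControlledConnected {X : Type*} [TopologicalSpace X] [T2Space X]
    [CWComplex (Set.univ : Set X)] {M : Type*} [MetricSpace M] (h : X → M)
    (τ : GeodesicRay M) : Prop :=
  ∃ lag : ℝ → ℝ≥0, Tendsto (fun t : ℝ => t - (lag t : ℝ)) atTop atTop ∧
    ∀ t : ℝ, ∀ x ∈ horoSubcomplex h τ t, ∀ y ∈ horoSubcomplex h τ t,
      JoinedIn (horoSubcomplex h τ (t - (lag t : ℝ))) x y

/-- The invariant `Σ¹(ρ)` of an isometric action `ρ` of `G` on `M`: the boundary points over which
`ρ` is controlled connected. Here `X` is the universal cover of a `K(G,1)`-complex, that is, a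
contractible free `G`-CW-complex, with cocompact `1`-skeleton, and `h` is a continuous `G`-map from
the `1`-skeleton of `X` to `M` (the values of `h` off the `1`-skeleton play no role). The condition
is imposed for every choice of `X`, of `h` and of the ray representing the boundary point. -/
def SigmaOne {G : Type u₁} [Group G] {M : Type u₂} [MetricSpace M] (ρ : G →* (M ≃ᵢ M)) :
    Set (Boundary M) :=
  {e | ∀ (X : Type u₃) [TopologicalSpace X] [T2Space X] [CWComplex (Set.univ : Set X)]
      [ContractibleSpace X] [MulAction G X], IsFreeGCW G X →
      IsCocompactSubset G (oneSkeleton X) →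
      ∀ h : X → M, ContinuousOn h (oneSkeleton X) →
        (∀ (g : G), ∀ x ∈ oneSkeleton X, h (g • x) = ρ g (h x)) →
        ∀ τ : GeodesicRay M, τ.endpoint = e → IsControlledConnected h τ}

end ControlledConnectivity

/-! ### The geometric realization of a graph, with its path metric -/

section Realization

variable {V : Type*}

/-- The vertex `u` as a point in barycentric coordinates. -/
noncomputable def vertexFn (u : V) : V → ℝ := Set.indicator {u} fun _ => 1

/-- The geometric realization of a graph, in barycentric coordinates: the union of its vertices
and of the segments that join adjacent vertices. -/
def Realization (Γ : SimpleGraph V) : Type _ :=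
  {f : V → ℝ // ∃ u v, (u = v ∨ Γ.Adj u v) ∧ f ∈ segment ℝ (vertexFn u) (vertexFn v)}

namespace Realization

variable {Γ : SimpleGraph V}

/-- A vertex of the graph as a point of the realization. -/
noncomputable def vertex (Γ : SimpleGraph V) (u : V) : Realization Γ :=
  ⟨vertexFn u, u, u, Or.inl rfl, left_mem_segment ℝ _ _⟩

/-- The two points lie on a common closed edge (or are the same vertex). -/
def SameEdge (p q : Realization Γ) : Prop :=
  ∃ u v, (u = v ∨ Γ.Adj u v) ∧ p.1 ∈ segment ℝ (vertexFn u) (vertexFn v) ∧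
    q.1 ∈ segment ℝ (vertexFn u) (vertexFn v)

/-- The length of the segment between two points of a common edge, every edge having length `1`:
it is the maximal change of a barycentric coordinate. -/
noncomputable def segLength (p q : Realization Γ) : ℝ≥0∞ := ⨆ w, edist (p.1 w) (q.1 w)

/-- `IsPolyPath p q L`: there is a path of length `L` from `p` to `q` that is a concatenation of
finitely many segments, each contained in a closed edge. -/
inductive IsPolyPath : Realization Γ → Realization Γ → ℝ≥0∞ → Prop
  | refl (p : Realization Γ) : IsPolyPath p p 0
  | cons (p q r : Realization Γ) (L : ℝ≥0∞) (hpq : SameEdge p q) (hqr : IsPolyPath q r L) :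
      IsPolyPath p r (segLength p q + L)

theorem SameEdge.symm {p q : Realization Γ} (h : SameEdge p q) : SameEdge q p := by
  obtain ⟨u, v, huv, hp, hq⟩ := h
  exact ⟨u, v, huv, hq, hp⟩

theorem sameEdge_self (p : Realization Γ) : SameEdge p p := by
  obtain ⟨u, v, huv, hp⟩ := p.2
  exact ⟨u, v, huv, hp, hp⟩

theorem segLength_comm (p q : Realization Γ) : segLength p q = segLength q p := by
  simp only [segLength, edist_comm]

theorem segLength_self (p : Realization Γ) : segLength p p = 0 := by
  simp [segLength]

theorem segLength_triangle (p q r : Realization Γ) :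
    segLength p r ≤ segLength p q + segLength q r := by
  refine iSup_le fun w => (edist_triangle _ (q.1 w) _).trans (add_le_add ?_ ?_)
  · exact le_iSup (fun w => edist (p.1 w) (q.1 w)) w
  · exact le_iSup (fun w => edist (q.1 w) (r.1 w)) w

theorem IsPolyPath.trans {p q r : Realization Γ} {L L' : ℝ≥0∞} (h : IsPolyPath p q L)
    (h' : IsPolyPath q r L') : IsPolyPath p r (L + L') := by
  induction h with
  | refl p => simpa using h'
  | cons p a b L hpa _ ih =>
    rw [add_assoc]
    exact IsPolyPath.cons p a r _ hpa (ih h')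

theorem IsPolyPath.single {p q : Realization Γ} (h : SameEdge p q) :
    IsPolyPath p q (segLength p q) := by
  simpa using IsPolyPath.cons p q q 0 h (IsPolyPath.refl q)

theorem IsPolyPath.symm {p q : Realization Γ} {L : ℝ≥0∞} (h : IsPolyPath p q L) :
    IsPolyPath q p L := by
  induction h with
  | refl p => exact IsPolyPath.refl p
  | cons p a b L hpa _ ih =>
    rw [add_comm, segLength_comm]
    exact ih.trans (IsPolyPath.single hpa.symm)

theorem IsPolyPath.segLength_le {p q : Realization Γ} {L : ℝ≥0∞} (h : IsPolyPath p q L) :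
    segLength p q ≤ L := by
  induction h with
  | refl p => rw [segLength_self]
  | cons p a b L _ _ ih => exact (segLength_triangle p a b).trans (add_le_add le_rfl ih)

/-- The path metric: the infimum of the lengths of the piecewise linear paths (`∞` if there is
none). -/
noncomputable instance : EMetricSpace (Realization Γ) where
  edist p q := ⨅ (L : ℝ≥0∞) (_ : IsPolyPath p q L), L
  edist_self p := le_antisymm (iInf₂_le 0 (IsPolyPath.refl p)) (zero_le)
  edist_comm p q := by
    apply le_antisymm <;> exact le_iInf₂ fun L h => iInf₂_le L h.symm
  edist_triangle p q r := by
    refine ENNReal.le_of_forall_pos_le_add fun ε hε hfin => ?_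
    have hε' : (0 : ℝ≥0∞) < (ε / 2 : ℝ≥0) := by
      exact_mod_cast half_pos hε
    rw [ENNReal.add_lt_top] at hfin
    have h₁ := ENNReal.lt_add_right hfin.1.ne hε'.ne'
    have h₂ := ENNReal.lt_add_right hfin.2.ne hε'.ne'
    simp only [iInf_lt_iff] at h₁ h₂
    obtain ⟨L, hL, hL'⟩ := h₁
    obtain ⟨L₂, hL₂, hL₂'⟩ := h₂
    refine (iInf₂_le _ (hL.trans hL₂)).trans ((add_le_add hL'.le hL₂'.le).trans ?_)
    rw [add_add_add_comm, ← ENNReal.coe_add, add_halves]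
  eq_of_edist_eq_zero {p q} h := by
    have h0 : segLength p q ≤ 0 := h ▸ le_iInf₂ fun L hL => hL.segLength_le
    refine Subtype.ext (funext fun w => ?_)
    have := (le_iSup (fun w => edist (p.1 w) (q.1 w)) w).trans h0
    exact edist_le_zero.1 this

theorem edist_def (p q : Realization Γ) :
    edist p q = ⨅ (L : ℝ≥0∞) (_ : IsPolyPath p q L), L := rfl

theorem coord_mem_Icc (p : Realization Γ) (w : V) : p.1 w ∈ Set.Icc (0 : ℝ) 1 := by
  obtain ⟨u, v, -, a, b, ha, hb, hab, hp⟩ := p.2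
  have h : ∀ x : V, vertexFn x w ∈ Set.Icc (0 : ℝ) 1 := fun x => by
    by_cases hx : w = x <;> simp [vertexFn, hx]
  rw [← hp]
  exact (convex_Icc (0 : ℝ) 1) (h u) (h v) ha hb hab

theorem segLength_ne_top (p q : Realization Γ) : segLength p q ≠ ⊤ := by
  refine ne_top_of_le_ne_top ENNReal.one_ne_top (iSup_le fun w => ?_)
  rw [edist_dist, ← ENNReal.ofReal_one]
  refine ENNReal.ofReal_le_ofReal ?_
  have h₁ := coord_mem_Icc p w
  have h₂ := coord_mem_Icc q w
  rw [Real.dist_eq, abs_le]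
  constructor <;> linarith [h₁.1, h₁.2, h₂.1, h₂.2]

theorem IsPolyPath.edist_ne_top {p q : Realization Γ} {L : ℝ≥0∞} (h : IsPolyPath p q L)
    (hL : L ≠ ⊤) : edist p q ≠ ⊤ :=
  ne_top_of_le_ne_top hL (iInf₂_le L h)

theorem SameEdge.edist_ne_top {p q : Realization Γ} (h : SameEdge p q) : edist p q ≠ ⊤ :=
  (IsPolyPath.single h).edist_ne_top (segLength_ne_top p q)

theorem edist_trans_ne_top {p q r : Realization Γ} (h : edist p q ≠ ⊤) (h' : edist q r ≠ ⊤) :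
    edist p r ≠ ⊤ :=
  ne_top_of_le_ne_top (ENNReal.add_ne_top.2 ⟨h, h'⟩) (edist_triangle p q r)

/-- In a connected graph the path metric is finite. -/
theorem edist_ne_top_of_connected (hΓ : Γ.Connected) (p q : Realization Γ) : edist p q ≠ ⊤ := by
  have hv : ∀ {u v : V}, Γ.Walk u v → edist (vertex Γ u) (vertex Γ v) ≠ ⊤ := by
    intro u v W
    induction W with
    | nil => simp
    | @cons u v w huv _ ih =>
      refine edist_trans_ne_top (q := vertex Γ v) (SameEdge.edist_ne_top ?_) ih
      exact ⟨u, v, Or.inr huv, left_mem_segment ℝ _ _, right_mem_segment ℝ _ _⟩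
  have hp : ∀ p : Realization Γ, ∃ u, edist p (vertex Γ u) ≠ ⊤ := fun p => by
    obtain ⟨u, v, huv, hp⟩ := p.2
    exact ⟨u, SameEdge.edist_ne_top ⟨u, v, huv, hp, left_mem_segment ℝ _ _⟩⟩
  obtain ⟨u, hu⟩ := hp p
  obtain ⟨v, hv'⟩ := hp q
  obtain ⟨W⟩ := hΓ.preconnected u v
  rw [edist_comm] at hv'
  exact edist_trans_ne_top hu (edist_trans_ne_top (hv W) hv')

end Realization

end Realization

/-! ### The Cayley tree of a free group and the action on it -/

section CayleyTree

variable {ι : Type*} {A : Type*} [Group A]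

/-- The Cayley graph of a free group with respect to a free basis. -/
def cayleyGraph (b : FreeGroupBasis ι A) : SimpleGraph A := SimpleGraph.mulCayley (Set.range b)

theorem closure_range_basis (b : FreeGroupBasis ι A) : Subgroup.closure (Set.range b) = ⊤ := by
  have h : (Set.range b : Set A) =
      b.repr.symm.toMonoidHom '' Set.range (FreeGroup.of : ι → FreeGroup ι) := by
    rw [← Set.range_comp]; rfl
  rw [h, ← MonoidHom.map_closure, FreeGroup.closure_range_of, ← MonoidHom.range_eq_map,
    MonoidHom.range_eq_top]
  exact b.repr.symm.surjective

theorem cayleyGraph_reachable_mul (b : FreeGroupBasis ι A) (g : A) {s : A}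
    (hs : s ∈ Set.range b) : (cayleyGraph b).Reachable g (g * s) := by
  by_cases h : g = g * s
  · rw [← h]
  · refine SimpleGraph.Adj.reachable ?_
    rw [cayleyGraph, SimpleGraph.mulCayley_adj]
    exact ⟨h, Or.inl (by simpa using hs)⟩

theorem cayleyGraph_connected (b : FreeGroupBasis ι A) : (cayleyGraph b).Connected := by
  have key : ∀ g x : A, (cayleyGraph b).Reachable g (g * x) := fun g x => by
    have hx : x ∈ Subgroup.closure (Set.range b) := by rw [closure_range_basis]; trivial
    induction hx using Subgroup.closure_induction generalizing g with
    | mem s hs => exact cayleyGraph_reachable_mul b g hs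
    | one => rw [mul_one]
    | mul x y _ _ hx hy =>
      rw [← mul_assoc]
      exact (hx g).trans (hy (g * x))
    | inv x _ hx => simpa using (hx (g * x⁻¹)).symm
  exact { preconnected := fun g x => by simpa using key g (g⁻¹ * x), nonempty := ⟨1⟩ }

/-- The Cayley tree `T` of a free group with respect to a free basis, as a metric space: the
geometric realization of the Cayley graph with its path metric. -/
def CayleyTree (b : FreeGroupBasis ι A) : Type _ := Realization (cayleyGraph b)

noncomputable instance (b : FreeGroupBasis ι A) : MetricSpace (CayleyTree b) :=
  EMetricSpace.toMetricSpace (α := Realization (cayleyGraph b))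
    (Realization.edist_ne_top_of_connected (cayleyGraph_connected b))

theorem CayleyTree.edist_def (b : FreeGroupBasis ι A) (p q : CayleyTree b) :
    edist p q = ⨅ (L : ℝ≥0∞) (_ : Realization.IsPolyPath (Γ := cayleyGraph b) p q L), L := rfl

/-- The vertex of the Cayley tree given by an element of the group. -/
noncomputable def CayleyTree.vertex (b : FreeGroupBasis ι A) (a : A) : CayleyTree b :=
  Realization.vertex (cayleyGraph b) a

theorem comp_mem_segment {f : A → ℝ} {u v : A} (g : A)
    (hf : f ∈ segment ℝ (vertexFn u) (vertexFn v)) :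
    (fun w => f (g⁻¹ * w)) ∈ segment ℝ (vertexFn (g * u)) (vertexFn (g * v)) := by
  obtain ⟨a, c, ha, hc, hac, rfl⟩ := hf
  refine ⟨a, c, ha, hc, hac, funext fun w => ?_⟩
  have h : ∀ x : A, vertexFn (g * x) w = vertexFn x (g⁻¹ * w) := fun x => by
    by_cases hx : w = g * x
    · subst hx; simp [vertexFn]
    · have hx' : g⁻¹ * w ≠ x := fun h => hx (by rw [← h, mul_inv_cancel_left])
      simp [vertexFn, hx, hx']
  simp only [Pi.add_apply, Pi.smul_apply, h]

theorem cayleyGraph_adj_mul {b : FreeGroupBasis ι A} {u v : A} (g : A)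
    (h : u = v ∨ (cayleyGraph b).Adj u v) :
    g * u = g * v ∨ (cayleyGraph b).Adj (g * u) (g * v) := by
  rcases h with rfl | h
  · exact Or.inl rfl
  · exact Or.inr (SimpleGraph.mulCayley_adj_mul_iff_right.2 h)

/-- Left translation by `g`: the point with barycentric coordinates `f` goes to the point with
coordinates `w ↦ f (g⁻¹ w)`, so the vertex `u` goes to the vertex `g u`. -/
def CayleyTree.translate (b : FreeGroupBasis ι A) (g : A) (p : CayleyTree b) : CayleyTree b :=
  ⟨fun w => p.1 (g⁻¹ * w), by
    obtain ⟨u, v, huv, hp⟩ := p.2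
    exact ⟨g * u, g * v, cayleyGraph_adj_mul g huv, comp_mem_segment g hp⟩⟩

theorem CayleyTree.translate_one (b : FreeGroupBasis ι A) (p : CayleyTree b) :
    translate b 1 p = p :=
  Subtype.ext (funext fun w => by simp [translate])

theorem CayleyTree.translate_mul (b : FreeGroupBasis ι A) (g g' : A) (p : CayleyTree b) :
    translate b (g * g') p = translate b g (translate b g' p) :=
  Subtype.ext (funext fun w => by simp [translate, mul_assoc])

theorem CayleyTree.translate_path (b : FreeGroupBasis ι A) (g : A)
    {p q : Realization (cayleyGraph b)} {L : ℝ≥0∞} (h : Realization.IsPolyPath p q L) :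
    Realization.IsPolyPath (Γ := cayleyGraph b) (translate b g p) (translate b g q) L := by
  induction h with
  | refl p => exact Realization.IsPolyPath.refl _
  | cons p q r L hpq _ ih =>
    have hlen : Realization.segLength p q =
        Realization.segLength (Γ := cayleyGraph b) (translate b g p) (translate b g q) :=
      ((Equiv.mulLeft g⁻¹).iSup_comp (g := fun w => edist (p.1 w) (q.1 w))).symm
    rw [hlen]
    refine Realization.IsPolyPath.cons _ _ _ L ?_ ih
    obtain ⟨u, v, huv, hp, hq⟩ := hpq
    exact ⟨g * u, g * v, cayleyGraph_adj_mul g huv, comp_mem_segment g hp, comp_mem_segment g hq⟩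

theorem CayleyTree.edist_translate_le (b : FreeGroupBasis ι A) (g : A) (p q : CayleyTree b) :
    edist (translate b g p) (translate b g q) ≤ edist p q :=
  le_iInf₂ fun L hL => iInf₂_le L (translate_path b g hL)

theorem CayleyTree.isometry_translate (b : FreeGroupBasis ι A) (g : A) :
    Isometry (translate b g) := fun p q => by
  refine le_antisymm (edist_translate_le b g p q) ?_
  have h := edist_translate_le b g⁻¹ (translate b g p) (translate b g q)
  simpa only [← translate_mul, inv_mul_cancel, translate_one] using h

/-- The action of the free group `A` on its Cayley tree by left translations. -/
noncomputable def cayleyAction (b : FreeGroupBasis ι A) : A →* (CayleyTree b ≃ᵢ CayleyTree b) where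
  toFun g :=
    { toFun := CayleyTree.translate b g
      invFun := CayleyTree.translate b g⁻¹
      left_inv := fun p => by
        rw [← CayleyTree.translate_mul, inv_mul_cancel, CayleyTree.translate_one]
      right_inv := fun p => by
        rw [← CayleyTree.translate_mul, mul_inv_cancel, CayleyTree.translate_one]
      isometry_toFun := CayleyTree.isometry_translate b g }
  map_one' := IsometryEquiv.ext fun p => CayleyTree.translate_one b p
  map_mul' g g' := IsometryEquiv.ext fun p => CayleyTree.translate_mul b g g' p

/-- The action `ρ` of `G = B ⋊ A` on the Cayley tree of `A` induced by the projection `G → A`. -/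
noncomputable def semidirectAction (b : FreeGroupBasis ι A) {B : Type*} [Group B] (φ : A →* MulAut B) :
    (B ⋊[φ] A) →* (CayleyTree b ≃ᵢ CayleyTree b) :=
  (cayleyAction b).comp SemidirectProduct.rightHom

/-! ### Infinite words -/

/-- The element of `A` given by a letter: a basis element (`true`) or its inverse (`false`). -/
def letterVal (b : FreeGroupBasis ι A) (x : ι × Bool) : A := if x.2 then b x.1 else (b x.1)⁻¹

/-- An infinite word `c 0, c 1, c 2, …` is freely reduced: no letter is followed by its inverse. -/
def IsReducedWord (c : ℕ → ι × Bool) : Prop := ∀ n, c (n + 1) ≠ ((c n).1, !(c n).2)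

/-- The element of `A` given by the subword `c i, c (i + 1), …, c (j - 1)`. -/
def subwordVal (b : FreeGroupBasis ι A) (c : ℕ → ι × Bool) (i j : ℕ) : A :=
  ((List.range' i (j - i)).map fun n => letterVal b (c n)).prod

/-- The boundary point `e` of the Cayley tree is represented by the infinite word `c`: it is the
endpoint of a geodesic ray that visits at time `n` the vertex spelled by the first `n` letters. -/
def IsEndpointOfWord (b : FreeGroupBasis ι A) (c : ℕ → ι × Bool)
    (e : Boundary (CayleyTree b)) : Prop :=
  ∃ τ : GeodesicRay (CayleyTree b),
    (∀ n : ℕ, τ.toFun (n : ℝ≥0) = CayleyTree.vertex b (subwordVal b c 0 n)) ∧ τ.endpoint = e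

end CayleyTree

/-! Fix a vertex-like base point `v` of the `1`-skeleton. The `1`-skeleton is path connected and
cocompact and `h` is equivariant, so, up to a constant lag, joining points over a horoball reduces
to linking elements `(β, a)` of `B ⋊ A` with `a` in the horoball by right multiplications from a
fixed finite set (`IsFreeGCW.exists_smul_joinedIn`).

Changing `a` while keeping `β` is a walk in the Cayley graph. A horoball is an increasing union of
balls, so two of its vertices lie in a common ball and are joined by an edge path with bounded lag
(`rel_of_mem_horoball`).

The difficulty is to change `β`. The group `B` is generated by the elements `φ y s.left` with `y ∈
A` and `s` a generator of `B ⋊ A`. Right multiplication of `(γ, a)` by `s.left` multiplies `γ` by `φ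
a s.left`. The factor `φ y s.left` is thus available at `a = y`, possibly far from the horoball, but
equally at `a = N * y` for each `N ∈ φ.ker`. Hence it is enough that every orbit of `φ.ker` meets
every horoball (`SemidirectProduct.rel_of_generators`).

This is what the word provides (`CayleyTree.exists_mul_mem_horoball`). Let `w i` be its prefixes.
For arbitrarily large `i < j` the element `w j * (w i)⁻¹` lies in `φ.ker`, by normality, and carries
`τ i` to `τ j`. It pushes points towards the end by `j - i ≥ 1`, so the depth of the points of an
orbit is unbounded. -/

/-! ### Compactness and connectedness in CW complexes. -/

namespace Topology.CWComplex

open Metric Set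

variable {X : Type*} [TopologicalSpace X] [T2Space X] [CWComplex (univ : Set X)]

theorem isClosed_of_forall_closedCell {A : Set X}
    (h : ∀ n (j : RelCWComplex.cell (univ : Set X) n), IsClosed (A ∩ RelCWComplex.closedCell n j)) :
    IsClosed A :=
  (CWComplex.closed univ A (subset_univ _)).2 h

omit [T2Space X] in
/-- A closed cell meets only finitely many open cells. -/
theorem finite_openCell_meets_closedCell (n : ℕ) (j : RelCWComplex.cell (univ : Set X) n) :
    {e : Σ m, RelCWComplex.cell (univ : Set X) m |
      (RelCWComplex.openCell e.1 e.2 ∩ RelCWComplex.closedCell n j).Nonempty}.Finite := by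
  obtain ⟨I, hI⟩ := CWComplex.cellFrontier_subset_finite_openCell n j
  have hfin : ((⋃ m ∈ Iio n, Sigma.mk m '' (I m : Set (RelCWComplex.cell (univ : Set X) m))) ∪
      {⟨n, j⟩}).Finite :=
    ((finite_Iio n).biUnion fun m _ => ((I m).finite_toSet.image _)).union (finite_singleton _)
  refine hfin.subset ?_
  rintro e ⟨x, hx, hxj⟩
  rw [← RelCWComplex.cellFrontier_union_openCell_eq_closedCell] at hxj
  rcases hxj with hxj | hxj
  · left
    have := hI hxj
    simp only [mem_iUnion] at this
    obtain ⟨m, hm, i, hi, hxi⟩ := this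
    have he : e = ⟨m, i⟩ :=
      RelCWComplex.eq_of_not_disjoint_openCell (not_disjoint_iff.2 ⟨x, hx, hxi⟩)
    subst he
    simp only [mem_iUnion]
    exact ⟨m, hm, i, hi, rfl⟩
  · right
    exact RelCWComplex.eq_of_not_disjoint_openCell (not_disjoint_iff.2 ⟨x, hx, hxj⟩)

/-- A compact set meets only finitely many open cells. -/
theorem finite_openCell_meets_isCompact {K : Set X} (hK : IsCompact K) :
    {e : Σ m, RelCWComplex.cell (univ : Set X) m |
      (RelCWComplex.openCell e.1 e.2 ∩ K).Nonempty}.Finite := by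
  set J := {e : Σ m, RelCWComplex.cell (univ : Set X) m |
      (RelCWComplex.openCell e.1 e.2 ∩ K).Nonempty}
  by_contra hinf
  have hch : ∀ e : J, ∃ x, x ∈ RelCWComplex.openCell e.1.1 e.1.2 ∩ K := fun e => e.2
  choose p hp using hch
  have hpinj : Function.Injective p := fun e e' hee =>
    Subtype.ext (RelCWComplex.eq_of_not_disjoint_openCell
      (not_disjoint_iff.2 ⟨p e, (hp e).1, hee ▸ (hp e').1⟩))
  have : Infinite J := Set.infinite_coe_iff.2 hinf
  -- One point is chosen in each open cell that meets `K`. A closed cell contains finitely many of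
  -- these points, so every set of them is closed and they cannot accumulate in `K`.
  have hcl : ∀ T ⊆ range p, IsClosed T := by
    intro T hT
    refine isClosed_of_forall_closedCell fun n j => Set.Finite.isClosed ?_
    have hf := (finite_openCell_meets_closedCell n j).preimage
      (Subtype.val_injective (p := (· ∈ J))).injOn
    refine (hf.image p).subset ?_
    rintro x ⟨hxT, hxj⟩
    obtain ⟨e, rfl⟩ := hT hxT
    exact ⟨e, ⟨p e, (hp e).1, hxj⟩, rfl⟩
  obtain ⟨x, -, hx⟩ := (infinite_range_of_injective hpinj).exists_accPt_of_subset_isCompact hK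
    (range_subset_iff.2 fun e => (hp e).2)
  rw [accPt_principal_iff_clusterPt, ← mem_closure_iff_clusterPt,
    (hcl _ sdiff_subset).closure_eq] at hx
  exact hx.2 rfl

/-- A closed set that contains an open cell around each of its points is a subcomplex. -/
def subcomplexOfIsClosed (E : Set X) (hE : IsClosed E)
    (h : ∀ x ∈ E, ∃ (n : ℕ) (j : RelCWComplex.cell (univ : Set X) n),
      x ∈ RelCWComplex.openCell n j ∧ RelCWComplex.openCell n j ⊆ E) :
    RelCWComplex.Subcomplex (univ : Set X) where
  carrier := E
  I n := {j | RelCWComplex.openCell n j ⊆ E}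
  closed' := hE
  union' := by
    rw [empty_union]
    refine Subset.antisymm (iUnion_subset fun n => iUnion_subset fun j => j.2) fun x hx => ?_
    obtain ⟨n, j, hxj, hj⟩ := h x hx
    exact mem_iUnion.2 ⟨n, mem_iUnion.2 ⟨⟨j, hj⟩, hxj⟩⟩

omit [T2Space X] in
theorem isPathConnected_closedCell (n : ℕ) (j : RelCWComplex.cell (univ : Set X) n) :
    IsPathConnected (RelCWComplex.closedCell n j) :=
  ((convex_closedBall _ _).isPathConnected ⟨0, by simp⟩).image'
    (RelCWComplex.continuousOn n j)

omit [T2Space X] in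
-- Dimension at least `2` is needed: the sphere bounding a `1`-cell is two points.
theorem isPreconnected_cellFrontier (n : ℕ) (j : RelCWComplex.cell (univ : Set X) (n + 2)) :
    IsPreconnected (RelCWComplex.cellFrontier (n + 2) j) :=
  (isPreconnected_sphere (by rw [rank_fin_fun]; exact_mod_cast Nat.one_lt_succ_succ n) _ _).image _
    ((RelCWComplex.continuousOn _ j).mono sphere_subset_closedBall)

/-- Every closed cell of dimension at most `k` lies in `S` or is disjoint from `S`. -/
def SplitsCells (k : ℕ) (S : Set X) : Prop :=
  ∀ m ≤ k, ∀ j : RelCWComplex.cell (univ : Set X) m,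
    RelCWComplex.closedCell m j ⊆ S ∨ Disjoint (RelCWComplex.closedCell m j) S

/-- The frontier is connected, and its parts inside and outside `S` are both closed, as can be
tested on cells of lower dimension. Hence one of the parts is empty. -/
theorem SplitsCells.cellFrontier {n : ℕ} {S : Set X} (hS : SplitsCells (n + 1) S)
    (j : RelCWComplex.cell (univ : Set X) (n + 2)) :
    RelCWComplex.cellFrontier (n + 2) j ⊆ S ∨ Disjoint (RelCWComplex.cellFrontier (n + 2) j) S := by
  have h₁ : IsClosed (S ∩ RelCWComplex.cellFrontier (n + 2) j) := by
    refine isClosed_inter_cellFrontier_succ_of_le_isClosed_inter_closedCell (fun m hm i => ?_) j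
    rcases hS m hm i with h | h
    · rw [inter_eq_right.2 h]
      exact RelCWComplex.isClosed_closedCell
    · rw [h.symm.inter_eq]
      exact isClosed_empty
  have h₂ : IsClosed (Sᶜ ∩ RelCWComplex.cellFrontier (n + 2) j) := by
    refine isClosed_inter_cellFrontier_succ_of_le_isClosed_inter_closedCell (fun m hm i => ?_) j
    rcases hS m hm i with h | h
    · rw [(disjoint_compl_left_iff_subset.2 h).inter_eq]
      exact isClosed_empty
    · rw [inter_eq_right.2 h.subset_compl_right]
      exact RelCWComplex.isClosed_closedCell
  have h₃ := isPreconnected_closed_iff.1 (isPreconnected_cellFrontier n j) _ _ h₁ h₂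
    (fun x hx => by by_cases hxS : x ∈ S <;> simp [hxS, hx])
  by_contra! hcon
  obtain ⟨⟨x, hx, hxS⟩, h⟩ := hcon.imp_left not_subset.1
  obtain ⟨y, hy, hyS⟩ := not_disjoint_iff.1 h
  obtain ⟨z, -, hz, hz'⟩ := h₃ ⟨y, hy, hyS, hy⟩ ⟨x, hx, hxS, hx⟩
  exact hz'.1 hz.1

/-- The union of `S` and of the open `(k + 1)`-cells with frontier in `S`. -/
def fillCells (k : ℕ) (S : Set X) : Set X :=
  S ∪ ⋃ (j : RelCWComplex.cell (univ : Set X) k) (_ : RelCWComplex.cellFrontier k j ⊆ S),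
    RelCWComplex.openCell k j

theorem disjoint_skeleton_openCell_nat {n m : ℕ} (h : n < m)
    (j : RelCWComplex.cell (univ : Set X) m) :
    Disjoint (RelCWComplex.skeleton (univ : Set X) n : Set X) (RelCWComplex.openCell m j) :=
  RelCWComplex.disjoint_skeleton_openCell (by exact_mod_cast h)

theorem closedCell_subset_skeleton_of_le {n m : ℕ} (h : n ≤ m)
    (j : RelCWComplex.cell (univ : Set X) n) :
    RelCWComplex.closedCell n j ⊆ (RelCWComplex.skeleton (univ : Set X) m : Set X) :=
  (RelCWComplex.closedCell_subset_skeleton n j).trans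
    (RelCWComplex.skeleton_mono (by exact_mod_cast h))

theorem fillCells_inter_skeleton {n m : ℕ} (h : n < m) (S : Set X) :
    fillCells m S ∩ (RelCWComplex.skeleton (univ : Set X) n : Set X) ⊆ S := by
  rintro x ⟨hx | hx, hxn⟩
  · exact hx
  · simp only [mem_iUnion] at hx
    obtain ⟨j, -, hxj⟩ := hx
    exact absurd hxj (disjoint_left.1 (disjoint_skeleton_openCell_nat h j) hxn)

theorem fillCells_subset_skeleton {n : ℕ} {S : Set X}
    (hS : S ⊆ (RelCWComplex.skeleton (univ : Set X) n : Set X)) :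
    fillCells (n + 1) S ⊆ (RelCWComplex.skeleton (univ : Set X) (n + 1 : ℕ) : Set X) := by
  refine union_subset (hS.trans (RelCWComplex.skeleton_mono (by exact_mod_cast n.le_succ)))
    (iUnion₂_subset fun j _ => ?_)
  exact (RelCWComplex.openCell_subset_closedCell _ j).trans
    (RelCWComplex.closedCell_subset_skeleton _ j)

/-- Filling changes nothing in lower dimensions. An `(n + 2)`-cell is filled if its frontier lies in
`S`; otherwise its frontier misses `S` and the whole closed cell stays outside. -/
theorem SplitsCells.fillCells {n : ℕ} {S : Set X} (hS : SplitsCells (n + 1) S)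
    (hsub : S ⊆ (RelCWComplex.skeleton (univ : Set X) (n + 1 : ℕ) : Set X)) :
    SplitsCells (n + 2) (fillCells (n + 2) S) := by
  intro m hm j
  rcases hm.lt_or_eq with hm | rfl
  · refine (hS m (Nat.lt_succ_iff.1 hm) j).imp (fun h => h.trans subset_union_left) fun h => ?_
    refine disjoint_left.2 fun x hx hxS => disjoint_left.1 h hx ?_
    exact fillCells_inter_skeleton (Nat.lt_succ_self (n + 1)) S
      ⟨hxS, closedCell_subset_skeleton_of_le (Nat.lt_succ_iff.1 hm) j hx⟩
  · rw [← RelCWComplex.cellFrontier_union_openCell_eq_closedCell]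
    refine (hS.cellFrontier j).imp (fun h => union_subset (h.trans subset_union_left) ?_)
      fun h => disjoint_union_left.2 ⟨?_, ?_⟩
    · exact (subset_iUnion₂ (s := fun j (_ : RelCWComplex.cellFrontier (n + 2) j ⊆ S) =>
        RelCWComplex.openCell (n + 2) j) j h).trans subset_union_right
    · refine disjoint_left.2 fun x hx hxS => disjoint_left.1 h hx ?_
      exact fillCells_inter_skeleton (Nat.lt_succ_self (n + 1)) S
        ⟨hxS, RelCWComplex.cellFrontier_subset_skeleton (n + 1) j hx⟩
    · refine disjoint_union_right.2 ⟨?_, disjoint_iUnion₂_right.2 fun i hi => ?_⟩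
      · exact ((disjoint_skeleton_openCell_nat (Nat.lt_succ_self (n + 1)) j).mono_left hsub).symm
      · refine RelCWComplex.disjoint_openCell_of_ne fun hij => ?_
        obtain rfl : j = i := by simpa using hij
        -- A nonempty frontier cannot both lie in `S` and miss `S`.
        obtain ⟨x, hx⟩ := RelCWComplex.nonempty_cellFrontier (Nat.succ_ne_zero (n + 1)) j
        exact disjoint_left.1 h hx (hi hx)

/-- A nonempty subset of the `1`-skeleton of a connected complex that splits the cells of dimension
at most `1` is the whole `1`-skeleton. -/
theorem SplitsCells.oneSkeleton_subset [PreconnectedSpace X] {S : Set X}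
    (hS : SplitsCells 1 S) (hne : S.Nonempty)
    (hsub : S ⊆ (RelCWComplex.skeleton (univ : Set X) (1 : ℕ) : Set X)) :
    (RelCWComplex.skeleton (univ : Set X) (1 : ℕ) : Set X) ⊆ S := by
  -- `S` is extended one dimension at a time; `U n` lives in the `(n + 1)`-skeleton. The union
  -- splits all cells, so it is clopen and hence everything, while its trace on the `1`-skeleton is
  -- still `S`.
  let U : ℕ → Set X := fun n => Nat.rec S (fun n T => CWComplex.fillCells (n + 2) T) n
  have hU : ∀ n, SplitsCells (n + 1) (U n) ∧
      U n ⊆ (RelCWComplex.skeleton (univ : Set X) (n + 1 : ℕ) : Set X) := by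
    intro n
    induction n with
    | zero => exact ⟨hS, hsub⟩
    | succ n ih => exact ⟨ih.1.fillCells ih.2, fillCells_subset_skeleton ih.2⟩
  have hmono : Monotone U := monotone_nat_of_le_succ fun n => subset_union_left
  have hUS : ∀ n, U n ∩ (RelCWComplex.skeleton (univ : Set X) (1 : ℕ) : Set X) ⊆ S := by
    intro n
    induction n with
    | zero => exact inter_subset_left
    | succ n ih =>
      rintro x ⟨hx, hx'⟩
      exact ih ⟨fillCells_inter_skeleton (n := 1) (by lia) (U n) ⟨hx, hx'⟩, hx'⟩
  have hsplit : ∀ m (j : RelCWComplex.cell (univ : Set X) m),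
      RelCWComplex.closedCell m j ⊆ ⋃ n, U n ∨
        Disjoint (RelCWComplex.closedCell m j) (⋃ n, U n) := by
    intro m j
    refine or_iff_not_imp_right.2 fun h => ?_
    obtain ⟨x, hxj, hx⟩ := not_disjoint_iff.1 h
    obtain ⟨k, hk⟩ := mem_iUnion.1 hx
    refine (((hU (max k m)).1 m (by lia) j).resolve_right ?_).trans (subset_iUnion U _)
    exact not_disjoint_iff.2 ⟨x, hxj, hmono (le_max_left k m) hk⟩
  have hclopen : IsClopen (⋃ n, U n) := by
    refine ⟨isClosed_of_forall_closedCell fun m j => ?_,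
      isClosed_compl_iff.1 (isClosed_of_forall_closedCell fun m j => ?_)⟩
    · rcases hsplit m j with h | h
      · rw [inter_eq_right.2 h]
        exact RelCWComplex.isClosed_closedCell
      · rw [h.symm.inter_eq]
        exact isClosed_empty
    · rcases hsplit m j with h | h
      · rw [(disjoint_compl_left_iff_subset.2 h).inter_eq]
        exact isClosed_empty
      · rw [inter_eq_right.2 h.subset_compl_right]
        exact RelCWComplex.isClosed_closedCell
  have huniv := hclopen.eq_univ (hne.mono (subset_iUnion U 0))
  intro x hx
  have hxU : x ∈ ⋃ n, U n := huniv ▸ mem_univ x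
  obtain ⟨n, hn⟩ := mem_iUnion.1 hxU
  exact hUS n ⟨hn, hx⟩

end Topology.CWComplex

/-! ### Paths and compact sets in the `1`-skeleton, and the action on its cells. -/

section OneSkeleton

open Topology.CWComplex Set

variable {X : Type*} [TopologicalSpace X] [T2Space X] [CWComplex (univ : Set X)]

theorem oneSkeleton_eq :
    oneSkeleton X = (RelCWComplex.skeleton (univ : Set X) (1 : ℕ) : Set X) := by
  rw [Nat.cast_one]
  rfl

theorem closedCell_subset_oneSkeleton {m : ℕ} (hm : m ≤ 1)
    (i : RelCWComplex.cell (univ : Set X) m) : RelCWComplex.closedCell m i ⊆ oneSkeleton X :=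
  oneSkeleton_eq (X := X) ▸ closedCell_subset_skeleton_of_le hm i

theorem mem_oneSkeleton_iff {x : X} :
    x ∈ oneSkeleton X ↔
      ∃ m ≤ 1, ∃ i : RelCWComplex.cell (univ : Set X) m, x ∈ RelCWComplex.openCell m i := by
  rw [oneSkeleton_eq, SetLike.mem_coe, CWComplex.mem_skeleton_iff]
  simp

/-- The `1`-skeleton of a connected CW complex is path connected. -/
theorem joinedIn_oneSkeleton [PreconnectedSpace X] {x y : X} (hx : x ∈ oneSkeleton X)
    (hy : y ∈ oneSkeleton X) : JoinedIn (oneSkeleton X) x y := by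
  -- Closed cells are path connected, so a path component of the `1`-skeleton contains each closed
  -- cell that it meets.
  have hS : SplitsCells 1 {z | JoinedIn (oneSkeleton X) x z} := by
    intro m hm i
    refine or_iff_not_imp_right.2 fun h z hz => ?_
    obtain ⟨w, hw, hxw⟩ := not_disjoint_iff.1 h
    exact hxw.trans (((isPathConnected_closedCell m i).joinedIn w hw z hz).mono
      (closedCell_subset_oneSkeleton hm i))
  refine hS.oneSkeleton_subset ⟨x, JoinedIn.refl hx⟩ (fun z hz => ?_) (oneSkeleton_eq (X := X) ▸ hy)
  exact oneSkeleton_eq (X := X) ▸ hz.target_mem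

/-- A compact subset of the `1`-skeleton lies in finitely many cells of dimension at most `1`. -/
theorem exists_finite_cells_of_isCompact {K : Set X} (hK : IsCompact K)
    (hKY : K ⊆ oneSkeleton X) :
    ∃ J : Set (Σ m, RelCWComplex.cell (univ : Set X) m), J.Finite ∧ (∀ e ∈ J, e.1 ≤ 1) ∧
      K ⊆ ⋃ e ∈ J, RelCWComplex.openCell e.1 e.2 := by
  refine ⟨_, (finite_openCell_meets_isCompact hK).subset (sep_subset _ fun e => e.1 ≤ 1),
    fun e he => he.2, fun x hx => ?_⟩
  obtain ⟨m, hm, i, hxi⟩ := mem_oneSkeleton_iff.1 (hKY hx)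
  exact mem_iUnion₂.2 ⟨⟨m, i⟩, ⟨⟨x, hxi, hx⟩, hm⟩, hxi⟩

theorem JoinedIn.exists_isCompact {Z : Type*} [TopologicalSpace Z] {Y : Set Z} {x y : Z}
    (h : JoinedIn Y x y) :
    ∃ C ⊆ Y, IsCompact C ∧ JoinedIn C x y :=
  ⟨range h.somePath, range_subset_iff.2 h.somePath_mem, isCompact_range h.somePath.continuous,
    h.somePath, mem_range_self⟩

/-- The points of a compact subset of the `1`-skeleton can be joined to a base point within a
common compact subset of the `1`-skeleton. -/
theorem exists_isCompact_joinedIn [PreconnectedSpace X] {K : Set X} (hK : IsCompact K)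
    (hKY : K ⊆ oneSkeleton X) {v : X} (hv : v ∈ oneSkeleton X) :
    ∃ C ⊆ oneSkeleton X, IsCompact C ∧ ∀ x ∈ K, JoinedIn C x v := by
  obtain ⟨J, hJ, hJ1, hKJ⟩ := exists_finite_cells_of_isCompact hK hKY
  have hcell : ∀ e ∈ J, ∃ C ⊆ oneSkeleton X, IsCompact C ∧
      ∀ x ∈ RelCWComplex.closedCell e.1 e.2, JoinedIn C x v := by
    intro e he
    have hsub := closedCell_subset_oneSkeleton (hJ1 e he) e.2
    have hz := RelCWComplex.map_zero_mem_closedCell e.1 e.2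
    obtain ⟨C, hCY, hC, hj⟩ := (joinedIn_oneSkeleton (hsub hz) hv).exists_isCompact
    refine ⟨_, union_subset hsub hCY, RelCWComplex.isCompact_closedCell.union hC, fun x hx => ?_⟩
    exact (((isPathConnected_closedCell _ _).joinedIn x hx _ hz).mono subset_union_left).trans
      (hj.mono subset_union_right)
  choose! C hCY hC hj using hcell
  refine ⟨⋃ e ∈ J, C e, iUnion₂_subset hCY, hJ.isCompact_biUnion hC, fun x hx => ?_⟩
  obtain ⟨e, he, hxe⟩ := mem_iUnion₂.1 (hKJ hx)
  exact (hj e he x (RelCWComplex.openCell_subset_closedCell _ _ hxe)).mono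
    (subset_biUnion_of_mem he)

section Action

variable {G : Type*} [Group G] [MulAction G X]

theorem IsFreeGCW.image_closedCell (hX : IsFreeGCW G X) (g : G) {m n : ℕ}
    {i : RelCWComplex.cell (univ : Set X) m} {j : RelCWComplex.cell (univ : Set X) n}
    (h : (fun x : X => g • x) '' RelCWComplex.openCell m i = RelCWComplex.openCell n j) :
    (fun x : X => g • x) '' RelCWComplex.closedCell m i = RelCWComplex.closedCell n j := by
  have : ContinuousConstSMul G X := ⟨hX.continuous_smul⟩
  rw [← RelCWComplex.closure_openCell_eq_closedCell, ← RelCWComplex.closure_openCell_eq_closedCell,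
    ← h]
  exact (Homeomorph.smul g).image_closure _

/-- If the `1`-skeleton is cocompact, then some compact subset of it contains a translate of each
closed cell of dimension at most `1`. -/
theorem IsFreeGCW.exists_isCompact_closedCell_subset (hX : IsFreeGCW G X)
    (hY : IsCocompactSubset G (oneSkeleton X)) :
    ∃ W ⊆ oneSkeleton X, IsCompact W ∧ ∀ m ≤ 1, ∀ i : RelCWComplex.cell (univ : Set X) m,
      ∃ g : G, RelCWComplex.closedCell m i ⊆ (fun x : X => g • x) '' W := by
  obtain ⟨K, hK, hKY⟩ := hY
  have hKsub : K ⊆ oneSkeleton X := fun x hx => by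
    rw [hKY]
    exact mem_iUnion.2 ⟨1, x, hx, one_smul G x⟩
  obtain ⟨J, hJ, hJ1, hKJ⟩ := exists_finite_cells_of_isCompact hK hKsub
  refine ⟨⋃ e ∈ J, RelCWComplex.closedCell e.1 e.2,
    iUnion₂_subset fun e he => closedCell_subset_oneSkeleton (hJ1 e he) e.2,
    hJ.isCompact_biUnion fun e _ => RelCWComplex.isCompact_closedCell, fun m hm i => ?_⟩
  have hz := closedCell_subset_oneSkeleton hm i (RelCWComplex.map_zero_mem_closedCell m i)
  rw [hKY] at hz
  obtain ⟨g, k, hk, hgk⟩ := mem_iUnion.1 hz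
  obtain ⟨e, he, hke⟩ := mem_iUnion₂.1 (hKJ hk)
  obtain ⟨j, hj⟩ := hX.permutes g e.1 e.2
  -- The centre of the cell `i` lies in the translate by `g` of the open cell `e`, and open cells
  -- that meet are equal.
  have hej : (⟨e.1, j⟩ : Σ n, RelCWComplex.cell (univ : Set X) n) = ⟨m, i⟩ := by
    refine RelCWComplex.eq_of_not_disjoint_openCell (not_disjoint_iff.2
      ⟨_, ?_, RelCWComplex.map_zero_mem_openCell m i⟩)
    rw [← hj, ← hgk]
    exact ⟨k, hke, rfl⟩
  have hcl := hX.image_closedCell g hj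
  have hcl' : RelCWComplex.closedCell e.1 j = RelCWComplex.closedCell m i :=
    congrArg (fun f : Σ n, RelCWComplex.cell (univ : Set X) n => RelCWComplex.closedCell f.1 f.2) hej
  refine ⟨g, ?_⟩
  rw [← hcl', ← hcl]
  exact image_mono (subset_biUnion_of_mem (u := fun e => RelCWComplex.closedCell e.1 e.2) he)

end Action

/-- The frontier of an edge consists of `0`-cells. In higher dimensions a frontier may cover other
cells only partially. -/
theorem exists_subcomplex_coe_eq_closedCell {m : ℕ} (hm : m ≤ 1)
    (i : RelCWComplex.cell (univ : Set X) m) :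
    ∃ E : RelCWComplex.Subcomplex (univ : Set X), (E : Set X) = RelCWComplex.closedCell m i := by
  refine ⟨subcomplexOfIsClosed _ RelCWComplex.isClosed_closedCell fun x hx => ?_, rfl⟩
  rw [← RelCWComplex.cellFrontier_union_openCell_eq_closedCell] at hx
  rcases hx with hx | hx
  · rcases hm.lt_or_eq with hm | rfl
    · obtain rfl : m = 0 := by lia
      rw [RelCWComplex.cellFrontier_zero_eq_empty] at hx
      exact hx.elim
    · have hx' := RelCWComplex.cellFrontier_subset_closedCell 1 i hx
      obtain ⟨u, v, huv⟩ := CWComplex.exists_cellFrontier_one_eq i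
      have key : ∀ w : RelCWComplex.cell (univ : Set X) 0, x ∈ RelCWComplex.closedCell 0 w →
          x ∈ RelCWComplex.openCell 0 w ∧
            RelCWComplex.openCell 0 w ⊆ RelCWComplex.closedCell 1 i := by
        intro w hw
        rw [RelCWComplex.closedCell_zero_eq_singleton] at hw
        rw [RelCWComplex.openCell_zero_eq_singleton]
        exact ⟨hw, singleton_subset_iff.2 (hw ▸ hx')⟩
      rw [huv] at hx
      exact hx.elim (fun h => ⟨0, u, key u h⟩) fun h => ⟨0, v, key v h⟩
  · exact ⟨m, i, hx, RelCWComplex.openCell_subset_closedCell m i⟩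

/-! ### Horoballs and their subcomplexes. -/

variable {M : Type*} [MetricSpace M]

theorem GeodesicRay.mem_horoball_iff {τ : GeodesicRay M} {t : ℝ} {x : M} :
    x ∈ τ.horoball t ↔ ∃ l : ℝ≥0, t ≤ l ∧ dist x (τ.toFun l) ≤ l - t := by
  simp [GeodesicRay.horoball]

theorem GeodesicRay.mem_horoball_of_dist_le {τ : GeodesicRay M} {t R : ℝ} {x y : M}
    (hx : x ∈ τ.horoball t) (h : dist y x ≤ R) : y ∈ τ.horoball (t - R) := by
  rw [GeodesicRay.mem_horoball_iff] at *
  obtain ⟨l, hl, hxl⟩ := hx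
  have := dist_triangle y x (τ.toFun l)
  have := dist_nonneg (x := y) (y := x)
  exact ⟨l, by linarith, by linarith⟩

theorem GeodesicRay.horoball_antitone (τ : GeodesicRay M) : Antitone τ.horoball := by
  intro s t hst x hx
  have := τ.mem_horoball_of_dist_le hx (R := t - s) (y := x) (by simpa using hst)
  simpa using this

/-- A point of the `1`-skeleton with image deep enough in a horoball lies in the subcomplex of the
horoball. -/
theorem mem_horoSubcomplex_of_mem_horoball {h : X → M} {D : ℝ}
    (hD : ∀ m ≤ 1, ∀ i : RelCWComplex.cell (univ : Set X) m, ∀ x ∈ RelCWComplex.closedCell m i,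
      ∀ y ∈ RelCWComplex.closedCell m i, dist (h x) (h y) ≤ D)
    {τ : GeodesicRay M} {t : ℝ} {x : X} (hx : x ∈ oneSkeleton X) (hxt : h x ∈ τ.horoball t) :
    x ∈ horoSubcomplex h τ (t - D) := by
  obtain ⟨m, hm, i, hxi⟩ := mem_oneSkeleton_iff.1 hx
  have hxi' := RelCWComplex.openCell_subset_closedCell m i hxi
  obtain ⟨E, hE⟩ := exists_subcomplex_coe_eq_closedCell hm i
  refine mem_iUnion₂.2 ⟨E, ⟨?_, ?_⟩, hE ▸ hxi'⟩
  · exact hE ▸ closedCell_subset_oneSkeleton hm i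
  · rw [hE]
    exact fun y hy => τ.mem_horoball_of_dist_le hxt (hD m hm i y hy x hxi')

theorem mem_of_mem_horoSubcomplex {h : X → M} {τ : GeodesicRay M} {t : ℝ} {x : X}
    (hx : x ∈ horoSubcomplex h τ t) : x ∈ oneSkeleton X ∧ h x ∈ τ.horoball t := by
  obtain ⟨E, hE, hx⟩ := mem_iUnion₂.1 hx
  exact ⟨hE.1 hx, hE.2 hx⟩

/-- At each time the centres of the balls for the two rays are at most `D` apart. -/
theorem GeodesicRay.exists_horoball_subset {τ τ' : GeodesicRay M} (h : τ.endpoint = τ'.endpoint) :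
    ∃ D : ℝ, ∀ t, τ.horoball t ⊆ τ'.horoball (t - D) := by
  obtain ⟨D, hD⟩ := Quotient.exact h
  refine ⟨D, fun t x hx => ?_⟩
  rw [GeodesicRay.mem_horoball_iff] at *
  obtain ⟨l, hl, hxl⟩ := hx
  have := dist_triangle x (τ.toFun l) (τ'.toFun l)
  have := hD l
  have := dist_nonneg (x := τ.toFun l) (y := τ'.toFun l)
  exact ⟨l, by linarith, by linarith⟩

/-- The balls that make up a horoball increase along the ray, so finitely many points of it share a
ball with centre at an integer time. -/
theorem GeodesicRay.eventually_of_mem_horoball {τ : GeodesicRay M} {t : ℝ} {x : M}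
    (hx : x ∈ τ.horoball t) :
    ∀ᶠ n : ℕ in atTop, t ≤ n ∧ dist x (τ.toFun n) ≤ n - t := by
  obtain ⟨l, hl, hxl⟩ := τ.mem_horoball_iff.1 hx
  filter_upwards [tendsto_natCast_atTop_atTop.eventually_ge_atTop (l : ℝ)] with n hln
  refine ⟨hl.trans hln, ?_⟩
  have h₁ := dist_triangle x (τ.toFun l) (τ.toFun n)
  rw [τ.isometry.dist_eq, NNReal.dist_eq, NNReal.coe_natCast, abs_sub_comm,
    abs_of_nonneg (by linarith)] at h₁
  linarith

end OneSkeleton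

/-! ### Edge paths in the realization of a graph. -/

namespace Realization

variable {V : Type*} {Γ : SimpleGraph V}

theorem eq_or_eq_of_mem_segment {f : V → ℝ} {u v w : V}
    (hf : f ∈ segment ℝ (vertexFn u) (vertexFn v)) (hw : 0 < f w) : w = u ∨ w = v := by
  obtain ⟨a, c, -, -, -, rfl⟩ := hf
  by_contra! h
  simp [vertexFn, h.1, h.2] at hw

theorem SameEdge.eq_or_adj {p q : Realization Γ} (h : SameEdge p q) {u v : V} (hu : 0 < p.1 u)
    (hv : 0 < q.1 v) : u = v ∨ Γ.Adj u v := by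
  obtain ⟨x, y, hxy, hp, hq⟩ := h
  rcases eq_or_eq_of_mem_segment hp hu with rfl | rfl <;>
    rcases eq_or_eq_of_mem_segment hq hv with rfl | rfl
  · exact Or.inl rfl
  · exact hxy
  · exact hxy.imp Eq.symm SimpleGraph.Adj.symm
  · exact Or.inl rfl

theorem exists_coord_pos (p : Realization Γ) : ∃ u, 0 < p.1 u := by
  obtain ⟨u, v, -, a, c, ha, hc, hac, hp⟩ := p.2
  have h : ∀ x y : V, 0 ≤ vertexFn x y := fun x y => Set.indicator_nonneg (by simp) y
  have h1 : ∀ x : V, vertexFn x x = 1 := fun x => by simp [vertexFn]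
  rcases ha.eq_or_lt with rfl | ha
  · obtain rfl : c = 1 := by linarith
    exact ⟨v, by simp [← hp, h1]⟩
  · refine ⟨u, ?_⟩
    have := mul_nonneg hc (h v u)
    simp only [← hp, Pi.add_apply, Pi.smul_apply, smul_eq_mul, h1]
    linarith

theorem segLength_le_one (p q : Realization Γ) : segLength p q ≤ 1 := by
  refine iSup_le fun w => ?_
  rw [edist_dist, ← ENNReal.ofReal_one]
  exact ENNReal.ofReal_le_ofReal
    ((Real.dist_le_of_mem_Icc (coord_mem_Icc p w) (coord_mem_Icc q w)).trans (by norm_num))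

theorem edist_vertex_le_one {p : Realization Γ} {u : V} (hu : 0 < p.1 u) :
    edist (vertex Γ u) p ≤ 1 := by
  have h : SameEdge (vertex Γ u) p := by
    obtain ⟨x, y, hxy, hp⟩ := p.2
    refine ⟨x, y, hxy, ?_, hp⟩
    rcases eq_or_eq_of_mem_segment hp hu with rfl | rfl
    · exact left_mem_segment ℝ _ _
    · exact right_mem_segment ℝ _ _
  exact (iInf₂_le _ (IsPolyPath.single h)).trans (segLength_le_one _ _)

/-- A path in the realization is shadowed by an edge path that stays near it. -/
theorem IsPolyPath.reflTransGen_adj {p q : Realization Γ} {L : ℝ≥0∞} (h : IsPolyPath p q L)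
    {u v : V} (hu : 0 < p.1 u) (hv : 0 < q.1 v) :
    Relation.ReflTransGen (fun x y => Γ.Adj x y ∧ edist (vertex Γ x) q ≤ L + 1 ∧
      edist (vertex Γ y) q ≤ L + 1) u v := by
  induction h generalizing u with
  | refl p =>
    rcases (sameEdge_self p).eq_or_adj hu hv with rfl | h
    · exact .refl
    · exact .single ⟨h, by simpa using edist_vertex_le_one hu, by simpa using edist_vertex_le_one hv⟩
  | cons p q r L hpq hqr ih =>
    -- A vertex of positive weight at a point is an end of any edge containing that point, so the
    -- vertices chosen at consecutive break points are equal or adjacent.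
    obtain ⟨w, hw⟩ := exists_coord_pos q
    have hle : L + 1 ≤ segLength p q + L + 1 := add_le_add (le_add_self) le_rfl
    have hwv : Relation.ReflTransGen (fun x y => Γ.Adj x y ∧
        edist (vertex Γ x) r ≤ segLength p q + L + 1 ∧
        edist (vertex Γ y) r ≤ segLength p q + L + 1) w v :=
      Relation.ReflTransGen.mono (fun x y hxy =>
        ⟨hxy.1, hxy.2.1.trans hle, hxy.2.2.trans hle⟩) _ _ (ih hw hv)
    rcases hpq.eq_or_adj hu hw with rfl | h
    · exact hwv
    · refine .head ⟨h, ?_, ?_⟩ hwv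
      · rw [add_comm]
        exact (edist_triangle _ p _).trans
          (add_le_add (edist_vertex_le_one hu) (iInf₂_le _ (IsPolyPath.cons p q r L hpq hqr)))
      · refine le_trans ?_ hle
        rw [add_comm]
        exact (edist_triangle _ q _).trans
          (add_le_add (edist_vertex_le_one hw) (iInf₂_le _ hqr))

end Realization

/-! ### Horoballs in the Cayley tree and orbits of a normal subgroup. -/

namespace CayleyTree

variable {ι : Type*} {A : Type*} [Group A] (b : FreeGroupBasis ι A)

theorem translate_vertex (g a : A) : translate b g (vertex b a) = vertex b (g * a) := by
  refine Subtype.ext (funext fun w => ?_)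
  change Set.indicator {a} (fun _ => (1 : ℝ)) (g⁻¹ * w) = Set.indicator {g * a} (fun _ => 1) w
  classical
  simp only [Set.indicator_apply, Set.mem_singleton_iff, inv_mul_eq_iff_eq_mul]

theorem dist_vertex_mul (g x y : A) :
    dist (vertex b (g * x)) (vertex b (g * y)) = dist (vertex b x) (vertex b y) := by
  rw [← translate_vertex, ← translate_vertex, (isometry_translate b g).dist_eq]

/-- Two vertices at distance less than `r` are joined by an edge path that stays in a ball. -/
theorem reflTransGen_adj_of_dist_lt {x w : A} {r : ℝ} (h : dist (vertex b x) (vertex b w) < r) :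
    Relation.ReflTransGen (fun y z => (cayleyGraph b).Adj y z ∧
      dist (vertex b y) (vertex b w) ≤ r + 1 ∧ dist (vertex b z) (vertex b w) ≤ r + 1) x w := by
  have hr : 0 ≤ r := dist_nonneg.trans h.le
  have h' : edist (vertex b x) (vertex b w) < ENNReal.ofReal r := by
    rw [edist_dist]
    exact (ENNReal.ofReal_lt_ofReal_iff_of_nonneg dist_nonneg).2 h
  rw [CayleyTree.edist_def] at h'
  simp only [iInf_lt_iff] at h'
  obtain ⟨L, hL, hLr⟩ := h'
  have hpos : ∀ u : A, 0 < (vertex b u).1 u := fun u => by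
    change 0 < vertexFn u u
    simp [vertexFn]
  have key : ∀ y : A, (edist (vertex b y) (vertex b w) : ℝ≥0∞) ≤ L + 1 →
      dist (vertex b y) (vertex b w) ≤ r + 1 := by
    intro y hy
    have h2 : edist (vertex b y) (vertex b w) ≤ ENNReal.ofReal (r + 1) := by
      rw [ENNReal.ofReal_add hr zero_le_one, ENNReal.ofReal_one]
      exact hy.trans (add_le_add hLr.le le_rfl)
    rwa [edist_dist, ENNReal.ofReal_le_ofReal_iff (by linarith)] at h2
  exact Relation.ReflTransGen.mono (fun y z hyz => ⟨hyz.1, key y hyz.2.1, key z hyz.2.2⟩) _ _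
    (hL.reflTransGen_adj (hpos x) (hpos w))

variable {b} {τ : GeodesicRay (CayleyTree b)} {w : ℕ → A}

/-- Any two vertices of a horoball are joined by an edge path in a slightly larger horoball. -/
theorem reflTransGen_adj_of_mem_horoball (hτ : ∀ n : ℕ, τ.toFun n = vertex b (w n)) {t : ℝ}
    {x y : A} (hx : vertex b x ∈ τ.horoball t) (hy : vertex b y ∈ τ.horoball t) :
    Relation.ReflTransGen (fun u v => (cayleyGraph b).Adj u v ∧
      vertex b u ∈ τ.horoball (t - 2) ∧ vertex b v ∈ τ.horoball (t - 2)) x y := by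
  obtain ⟨n, ⟨htn, hxn⟩, -, hyn⟩ :=
    ((τ.eventually_of_mem_horoball hx).and (τ.eventually_of_mem_horoball hy)).exists
  have key : ∀ z, dist (vertex b z) (τ.toFun n) ≤ n - t →
      Relation.ReflTransGen (fun u v => (cayleyGraph b).Adj u v ∧
        vertex b u ∈ τ.horoball (t - 2) ∧ vertex b v ∈ τ.horoball (t - 2)) z (w n) := by
    intro z hz
    rw [hτ] at hz
    -- One unit comes from making the distance bound strict, the other from replacing a path by an
    -- edge path.
    have hball : ∀ u, dist (vertex b u) (vertex b (w n)) ≤ n - t + 1 + 1 →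
        vertex b u ∈ τ.horoball (t - 2) := by
      intro u hu
      rw [← hτ] at hu
      refine τ.mem_horoball_iff.2 ⟨n, ?_, ?_⟩ <;> rw [NNReal.coe_natCast] <;> linarith
    exact Relation.ReflTransGen.mono (fun u v huv => ⟨huv.1, hball u huv.2.1, hball v huv.2.2⟩)
      _ _ (reflTransGen_adj_of_dist_lt b (hz.trans_lt (lt_add_one _)))
  refine (key x hxn).trans (Relation.reflTransGen_swap.1 ?_)
  exact Relation.ReflTransGen.mono (fun u v huv => ⟨huv.1.symm, huv.2.2, huv.2.1⟩) _ _ (key y hyn)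

/-- If a normal subgroup contains `(w i)⁻¹ * w j` for arbitrarily large `i < j`, then its elements
move every vertex into any given horoball about the end of `w`. -/
theorem exists_mul_mem_horoball (hτ : ∀ n : ℕ, τ.toFun n = vertex b (w n)) {K : Subgroup A}
    [K.Normal] (hK : ∀ m, ∃ i ≥ m, ∃ j > i, (w i)⁻¹ * w j ∈ K) (y : A) (t : ℝ) :
    ∃ N ∈ K, vertex b (N * y) ∈ τ.horoball t := by
  by_contra! hcon
  -- `F` collects the depths of the orbit points, in the manner of a Busemann function; a value
  -- above `t` puts the point into the horoball.
  set F : Set ℝ := {r | ∃ N ∈ K, ∃ m : ℕ, r = m - dist (vertex b (N * y)) (τ.toFun m)}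
  have hbdd : BddAbove F := by
    refine ⟨t, ?_⟩
    rintro r ⟨N, hN, m, rfl⟩
    by_contra! hlt
    refine hcon N hN (τ.mem_horoball_iff.2 ⟨m, ?_, ?_⟩) <;> rw [NNReal.coe_natCast]
    · have := dist_nonneg (x := vertex b (N * y)) (y := τ.toFun m)
      linarith
    · linarith
  have hne : F.Nonempty := ⟨_, 1, K.one_mem, 0, rfl⟩
  -- A value within `1` of the supremum suffices, since the shift from `τ i` to `τ j` gains `j - i ≥
  -- 1`. Passing from `m` to `i ≥ m` loses nothing, by the triangle inequality.
  obtain ⟨_, ⟨N, hN, m, rfl⟩, hlt⟩ := exists_lt_of_lt_csSup hne (sub_one_lt (sSup F))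
  obtain ⟨i, him, j, hij, hmem⟩ := hK m
  have hg : w j * (w i)⁻¹ ∈ K := by
    simpa [mul_assoc] using Subgroup.Normal.conj_mem ‹_› _ hmem (w i)
  have h₁ : (j : ℝ) - dist (vertex b (w j * (w i)⁻¹ * N * y)) (τ.toFun j) ≤ sSup F :=
    le_csSup hbdd ⟨_, K.mul_mem hg hN, j, rfl⟩
  have h₂ : dist (vertex b (w j * (w i)⁻¹ * N * y)) (τ.toFun j) =
      dist (vertex b (N * y)) (τ.toFun i) := by
    rw [hτ, hτ, ← dist_vertex_mul b (w j * (w i)⁻¹) (N * y) (w i), inv_mul_cancel_right,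
      mul_assoc _ N y]
  have h₃ := dist_triangle (vertex b (N * y)) (τ.toFun m) (τ.toFun i)
  have him' : (m : ℝ) ≤ i := by exact_mod_cast him
  have hij' : (i : ℝ) + 1 ≤ j := by exact_mod_cast hij
  rw [τ.isometry.dist_eq, NNReal.dist_eq, NNReal.coe_natCast, NNReal.coe_natCast, abs_sub_comm,
    abs_of_nonneg (by linarith)] at h₃
  linarith

end CayleyTree

/-! ### Subwords in a subgroup. -/

section Words

variable {ι : Type*} {A : Type*} [Group A] (b : FreeGroupBasis ι A) (c : ℕ → ι × Bool)

theorem subwordVal_mul {i j k : ℕ} (hij : i ≤ j) (hjk : j ≤ k) :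
    subwordVal b c i j * subwordVal b c j k = subwordVal b c i k := by
  obtain ⟨p, rfl⟩ := Nat.exists_eq_add_of_le hij
  obtain ⟨q, rfl⟩ := Nat.exists_eq_add_of_le hjk
  simp only [subwordVal, ← List.prod_append, ← List.map_append]
  rw [show i + p + q - i = p + q by lia, Nat.add_sub_cancel_left, Nat.add_sub_cancel_left,
    List.range'_append_1]

/-- If infinitely many of the subwords share a start before `m`, two of them that end beyond `m`
differ by a subword in `K` that starts beyond `m`. Otherwise only finitely many start before `m`. -/
theorem exists_large_subwordVal_mem {K : Subgroup A}
    (hK : {p : ℕ × ℕ | p.1 < p.2 ∧ subwordVal b c p.1 p.2 ∈ K}.Infinite) (m : ℕ) :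
    ∃ i ≥ m, ∃ j > i, (subwordVal b c 0 i)⁻¹ * subwordVal b c 0 j ∈ K := by
  have heq : ∀ {i j : ℕ}, i ≤ j →
      subwordVal b c i j = (subwordVal b c 0 i)⁻¹ * subwordVal b c 0 j := fun {i j} hij => by
    rw [← subwordVal_mul b c (Nat.zero_le i) hij, inv_mul_cancel_left]
  by_cases h : ∃ i < m, {j | i < j ∧ subwordVal b c i j ∈ K}.Infinite
  · obtain ⟨i, -, hi⟩ := h
    obtain ⟨j, ⟨hij, hj⟩, hmj⟩ := hi.exists_gt m
    obtain ⟨k, ⟨hik, hk⟩, hjk⟩ := hi.exists_gt j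
    refine ⟨j, hmj.le, k, hjk, ?_⟩
    rw [heq hij.le] at hj
    rw [heq hik.le] at hk
    simpa [mul_assoc] using K.mul_mem (K.inv_mem hj) hk
  · push Not at h
    by_contra! hcon
    refine hK (((Set.finite_Iio m).biUnion fun i hi => (h i hi).image (Prod.mk i)).subset ?_)
    rintro ⟨i, j⟩ ⟨hij, hmem⟩
    refine Set.mem_iUnion₂.2 ⟨i, ?_, j, ⟨hij, hmem⟩, rfl⟩
    by_contra him
    exact hcon i (not_lt.1 him) j hij (heq hij.le ▸ hmem)

end Words

/-! ### Generation of the semidirect product. -/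

section Semidirect

variable {A B : Type*} [Group A] [Group B] {φ : A →* MulAut B} {S : Set (B ⋊[φ] A)}

/-- The kernel `B` of the projection is generated by the `A`-conjugates of the `B`-components of
the generators. -/
theorem SemidirectProduct.closure_left_eq_top (hS : Subgroup.closure S = ⊤) :
    Subgroup.closure {β : B | ∃ y : A, ∃ s ∈ S, β = φ y s.left} = ⊤ := by
  set N := Subgroup.closure {β : B | ∃ y : A, ∃ s ∈ S, β = φ y s.left}
  have hφ : ∀ (x : A), ∀ β ∈ N, φ x β ∈ N := by
    intro x β hβ
    induction hβ using Subgroup.closure_induction with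
    | mem β h =>
      obtain ⟨y, s, hs, rfl⟩ := h
      exact Subgroup.subset_closure ⟨x * y, s, hs, by simp⟩
    | one => simp
    | mul β γ _ _ hβ hγ => simpa using N.mul_mem hβ hγ
    | inv β _ hβ => simpa using hβ
  have hleft : ∀ g : B ⋊[φ] A, g.left ∈ N := by
    intro g
    have hg : g ∈ Subgroup.closure S := hS ▸ Subgroup.mem_top g
    induction hg using Subgroup.closure_induction with
    | mem s hs => exact Subgroup.subset_closure ⟨1, s, hs, by simp⟩
    | one => simp
    -- The `B`-component of `x * y` is `x.left * φ x.right y.left`, which is why `N` has to be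
    -- invariant under `A`.
    | mul x y _ _ hx hy => exact N.mul_mem hx (hφ _ _ hy)
    | inv x _ hx => exact hφ _ _ (N.inv_mem hx)
  exact eq_top_iff.2 fun β _ => by simpa using hleft (SemidirectProduct.inl β)

/-- A symmetric and transitive relation on `B ⋊ A` that links the elements over a set `H ⊆ A` in
each left coset of `A`, and over `H` links `g` to `g * s` for the `B`-components `s` of the
generators, links all elements over `H`, provided each `ker φ`-orbit meets `H`. -/
theorem SemidirectProduct.rel_of_generators (hS : Subgroup.closure S = ⊤)
    {r : B ⋊[φ] A → B ⋊[φ] A → Prop} (hsymm : ∀ {x y}, r x y → r y x)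
    (htrans : ∀ {x y z}, r x y → r y z → r x z) {H : Set A}
    (hH : ∀ β : B, ∀ a ∈ H, ∀ a' ∈ H, r ⟨β, a⟩ ⟨β, a'⟩)
    (hr : ∀ s ∈ S, ∀ β : B, ∀ a ∈ H, r ⟨β, a⟩ (⟨β, a⟩ * SemidirectProduct.inl s.left))
    (hker : ∀ y : A, ∃ N ∈ φ.ker, N * y ∈ H) {g g' : B ⋊[φ] A} (hg : g.right ∈ H)
    (hg' : g'.right ∈ H) : r g g' := by
  have key : ∀ β : B, ∀ γ : B, ∀ a ∈ H, ∀ a' ∈ H, r ⟨γ, a⟩ ⟨γ * β, a'⟩ := by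
    intro β
    have hβ : β ∈ Subgroup.closure {β : B | ∃ y : A, ∃ s ∈ S, β = φ y s.left} :=
      closure_left_eq_top hS ▸ Subgroup.mem_top β
    induction hβ using Subgroup.closure_induction with
    | mem β h =>
      obtain ⟨y, s, hs, rfl⟩ := h
      intro γ a ha a' ha'
      -- The move happens over `N * y ∈ H` instead of `y`: both act on `B` in the same way. Before
      -- and after it, the coset of `A` is traversed within `H`.
      obtain ⟨N, hN, hNy⟩ := hker y
      have h₁ := hr s hs γ (N * y) hNy
      have h₂ : (⟨γ, N * y⟩ * SemidirectProduct.inl s.left : B ⋊[φ] A) =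
          ⟨γ * φ y s.left, N * y⟩ := by
        ext <;> simp [MonoidHom.mem_ker.1 hN]
      exact htrans (htrans (hH γ a ha _ hNy) (h₂ ▸ h₁)) (hH _ _ hNy a' ha')
    | one =>
      intro γ a ha a' ha'
      simpa using hH γ a ha a' ha'
    | mul β₁ β₂ _ _ h₁ h₂ =>
      intro γ a ha a' ha'
      rw [← mul_assoc]
      exact htrans (h₁ γ a ha a' ha') (h₂ (γ * β₁) a' ha' a' ha')
    | inv β _ h =>
      intro γ a ha a' ha'
      simpa using hsymm (h (γ * β⁻¹) a' ha' a ha)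
  simpa using key (g.left⁻¹ * g'.left) g.left g.right hg g'.right hg'

end Semidirect

/-! ### Translating paths over horoballs. -/

section Joining

variable {G : Type*} [Group G] {X : Type*} [TopologicalSpace X] [T2Space X]
  [CWComplex (Set.univ : Set X)] [MulAction G X] {M : Type*} [MetricSpace M] {ρ : G →* (M ≃ᵢ M)}
  {h : X → M}

omit [T2Space X] [CWComplex (Set.univ : Set X)] in
theorem IsCocompactSubset.smul_mem {Y : Set X} (hY : IsCocompactSubset G Y) (g : G) {x : X}
    (hx : x ∈ Y) : g • x ∈ Y := by
  obtain ⟨K, -, rfl⟩ := hY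
  obtain ⟨g', k, hk, rfl⟩ := Set.mem_iUnion.1 hx
  exact Set.mem_iUnion.2 ⟨g * g', k, hk, mul_smul g g' k⟩

/-- A translate of a path whose image lies in a ball about `o` stays over a horoball if the
translate of `o` lies deep enough in it. -/
theorem JoinedIn.smul_horoball (hX : IsFreeGCW G X) (hY : IsCocompactSubset G (oneSkeleton X))
    (hρ : ∀ (g : G), ∀ x ∈ oneSkeleton X, h (g • x) = ρ g (h x)) {C : Set X}
    (hC : C ⊆ oneSkeleton X) {o : M} {R : ℝ} (hCR : ∀ x ∈ C, dist (h x) o ≤ R) {x y : X}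
    (hxy : JoinedIn C x y) {g : G} {τ : GeodesicRay M} {t : ℝ} (hg : ρ g o ∈ τ.horoball t) :
    JoinedIn (oneSkeleton X ∩ h ⁻¹' τ.horoball (t - R)) (g • x) (g • y) := by
  refine (hxy.map (hX.continuous_smul g)).mono ?_
  rintro _ ⟨z, hz, rfl⟩
  refine ⟨hY.smul_mem g (hC hz), ?_⟩
  rw [Set.mem_preimage, hρ g z (hC hz)]
  exact τ.mem_horoball_of_dist_le hg (((ρ g).isometry.dist_eq _ _).trans_le (hCR z hz))

theorem IsCompact.exists_dist_le {C : Set X} (hC : IsCompact C) (hCY : C ⊆ oneSkeleton X)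
    (hcont : ContinuousOn h (oneSkeleton X)) (o : M) : ∃ R : ℝ, ∀ x ∈ C, dist (h x) o ≤ R := by
  obtain ⟨R, hR⟩ := (hC.image_of_continuousOn (hcont.mono hCY)).isBounded.subset_closedBall o
  exact ⟨R, fun x hx => hR ⟨x, hx, rfl⟩⟩

/-- The points of a compact set can be joined to a base point uniformly over all translates. -/
theorem IsFreeGCW.exists_smul_joinedIn [PreconnectedSpace X] (hX : IsFreeGCW G X)
    (hY : IsCocompactSubset G (oneSkeleton X)) (hcont : ContinuousOn h (oneSkeleton X))
    (hρ : ∀ (g : G), ∀ x ∈ oneSkeleton X, h (g • x) = ρ g (h x)) {K : Set X} (hK : IsCompact K)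
    (hKY : K ⊆ oneSkeleton X) {v : X} (hv : v ∈ oneSkeleton X) (o : M) :
    ∃ R : ℝ, ∀ x ∈ K, dist (h x) o ≤ R ∧
      ∀ (g : G) (τ : GeodesicRay M) (t : ℝ), ρ g o ∈ τ.horoball t →
        JoinedIn (oneSkeleton X ∩ h ⁻¹' τ.horoball (t - R)) (g • x) (g • v) := by
  obtain ⟨C, hCY, hC, hjoin⟩ := exists_isCompact_joinedIn hK hKY hv
  obtain ⟨R, hR⟩ := hC.exists_dist_le hCY hcont o
  exact ⟨R, fun x hx => ⟨hR x (hjoin x hx).source_mem, fun g τ t hg =>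
    (hjoin x hx).smul_horoball hX hY hρ hCY hR hg⟩⟩

/-- The images of the cells of a cocompact `1`-skeleton have uniformly bounded diameter. -/
theorem IsFreeGCW.exists_dist_le_of_mem_closedCell (hX : IsFreeGCW G X)
    (hY : IsCocompactSubset G (oneSkeleton X)) (hcont : ContinuousOn h (oneSkeleton X))
    (hρ : ∀ (g : G), ∀ x ∈ oneSkeleton X, h (g • x) = ρ g (h x)) :
    ∃ D : ℝ, ∀ m ≤ 1, ∀ i : RelCWComplex.cell (Set.univ : Set X) m,
      ∀ x ∈ RelCWComplex.closedCell m i, ∀ y ∈ RelCWComplex.closedCell m i,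
        dist (h x) (h y) ≤ D := by
  obtain ⟨W, hWY, hW, hcell⟩ := hX.exists_isCompact_closedCell_subset hY
  obtain ⟨D, hD⟩ := Metric.isBounded_iff.1 (hW.image_of_continuousOn (hcont.mono hWY)).isBounded
  refine ⟨D, fun m hm i x hx y hy => ?_⟩
  obtain ⟨g, hg⟩ := hcell m hm i
  obtain ⟨x, hxW, rfl⟩ := hg hx
  obtain ⟨y, hyW, rfl⟩ := hg hy
  change dist (h (g • x)) (h (g • y)) ≤ D
  rw [hρ g x (hWY hxW), hρ g y (hWY hyW), (ρ g).isometry.dist_eq]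
  exact hD ⟨x, hxW, rfl⟩ ⟨y, hyW, rfl⟩

/-- It suffices to join points over a horoball, with a bounded lag, for one ray representing the
boundary point. -/
theorem IsControlledConnected.of_forall_joinedIn {D L : ℝ}
    (hD : ∀ m ≤ 1, ∀ i : RelCWComplex.cell (Set.univ : Set X) m,
      ∀ x ∈ RelCWComplex.closedCell m i, ∀ y ∈ RelCWComplex.closedCell m i, dist (h x) (h y) ≤ D)
    {τ τ' : GeodesicRay M} (hτ : τ.endpoint = τ'.endpoint)
    (hjoin : ∀ t, ∀ x ∈ oneSkeleton X, h x ∈ τ'.horoball t → ∀ y ∈ oneSkeleton X,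
      h y ∈ τ'.horoball t → JoinedIn (oneSkeleton X ∩ h ⁻¹' τ'.horoball (t - L)) x y) :
    IsControlledConnected h τ := by
  obtain ⟨E, hE⟩ := GeodesicRay.exists_horoball_subset hτ
  obtain ⟨E', hE'⟩ := GeodesicRay.exists_horoball_subset hτ.symm
  -- `E` and `E'` pay for changing to the ray `τ'` and back, `L` for the joining path, and `D` for
  -- passing from the preimage of a horoball to the subcomplex.
  refine ⟨fun _ => (E + L + E' + D).toNNReal, tendsto_atTop_add_const_right _ _ tendsto_id,
    fun t x hx y hy => ?_⟩
  obtain ⟨hxY, hxt⟩ := mem_of_mem_horoSubcomplex hx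
  obtain ⟨hyY, hyt⟩ := mem_of_mem_horoSubcomplex hy
  refine (hjoin _ x hxY (hE t hxt) y hyY (hE t hyt)).mono ?_
  rintro z ⟨hzY, hzt⟩
  have hlag := Real.le_coe_toNNReal (E + L + E' + D)
  have hz : h z ∈ τ.horoball (t - ((E + L + E' + D).toNNReal : ℝ) + D) :=
    τ.horoball_antitone (by linarith) (hE' _ hzt)
  simpa using mem_horoSubcomplex_of_mem_horoball hD hzY hz

end Joining

/-! ### Joining points over horoballs for the semidirect product. -/

section Semidirect

variable {ι : Type*} {A : Type*} [Group A] {b : FreeGroupBasis ι A} {B : Type*} [Group B]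
  {φ : A →* MulAut B}

theorem semidirectAction_vertex_one (g : B ⋊[φ] A) :
    semidirectAction b φ g (CayleyTree.vertex b 1) = CayleyTree.vertex b g.right :=
  (CayleyTree.translate_vertex b g.right 1).trans (by rw [mul_one])

/-- If the elements of `B ⋊ A` over a horoball are linked to their products with a basis of `A`,
then elements over a slightly smaller horoball in the same coset of `A` are linked. -/
theorem rel_of_mem_horoball {r : B ⋊[φ] A → B ⋊[φ] A → Prop} (hsymm : ∀ {x y}, r x y → r y x)
    (htrans : ∀ {x y z}, r x y → r y z → r x z) {τ : GeodesicRay (CayleyTree b)} {w : ℕ → A}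
    (hτ : ∀ n : ℕ, τ.toFun n = CayleyTree.vertex b (w n)) {t : ℝ} {β : B}
    (hrefl : ∀ a, CayleyTree.vertex b a ∈ τ.horoball (t - 2) → r ⟨β, a⟩ ⟨β, a⟩)
    (hr : ∀ a i, CayleyTree.vertex b a ∈ τ.horoball (t - 2) →
      r ⟨β, a⟩ (⟨β, a⟩ * SemidirectProduct.inr (b i)))
    {a a' : A} (ha : CayleyTree.vertex b a ∈ τ.horoball t)
    (ha' : CayleyTree.vertex b a' ∈ τ.horoball t) : r ⟨β, a⟩ ⟨β, a'⟩ := by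
  have hadj : ∀ x y : A, x⁻¹ * y ∈ Set.range b → CayleyTree.vertex b x ∈ τ.horoball (t - 2) →
      r ⟨β, x⟩ ⟨β, y⟩ := by
    rintro x y ⟨i, hi⟩ hx
    have heq : (⟨β, x⟩ * SemidirectProduct.inr (b i) : B ⋊[φ] A) = ⟨β, y⟩ := by
      ext <;> simp [hi]
    exact heq ▸ hr x i hx
  have hpath := CayleyTree.reflTransGen_adj_of_mem_horoball hτ ha ha'
  clear ha'
  induction hpath with
  | refl => exact hrefl a (τ.horoball_antitone (by linarith) ha)
  | tail _ hxy ih =>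
    refine htrans ih ?_
    -- An edge is right multiplication by a basis element in one of its two directions; symmetry of
    -- `r` covers the other.
    rcases ((SimpleGraph.mulCayley_adj _ _ _).1 hxy.1).2 with h | h
    · exact hadj _ _ h hxy.2.1
    · exact hsymm (hadj _ _ h hxy.2.2)

/-- Points over a horoball can be joined over a slightly larger horoball, with a constant lag. -/
theorem exists_forall_joinedIn_horoball [Finite ι] (hG : Group.FG (B ⋊[φ] A))
    {τ : GeodesicRay (CayleyTree b)} {w : ℕ → A}
    (hτ : ∀ n : ℕ, τ.toFun n = CayleyTree.vertex b (w n))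
    (hker : ∀ m, ∃ i ≥ m, ∃ j > i, (w i)⁻¹ * w j ∈ φ.ker)
    {X : Type*} [TopologicalSpace X] [T2Space X] [CWComplex (Set.univ : Set X)]
    [PreconnectedSpace X] [MulAction (B ⋊[φ] A) X] (hX : IsFreeGCW (B ⋊[φ] A) X)
    (hY : IsCocompactSubset (B ⋊[φ] A) (oneSkeleton X)) {h : X → CayleyTree b}
    (hcont : ContinuousOn h (oneSkeleton X))
    (hρ : ∀ g : B ⋊[φ] A, ∀ x ∈ oneSkeleton X, h (g • x) = semidirectAction b φ g (h x)) :
    ∃ L : ℝ, ∀ t, ∀ x ∈ oneSkeleton X, h x ∈ τ.horoball t → ∀ y ∈ oneSkeleton X,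
      h y ∈ τ.horoball t → JoinedIn (oneSkeleton X ∩ h ⁻¹' τ.horoball (t - L)) x y := by
  rcases (oneSkeleton X).eq_empty_or_nonempty with hempty | ⟨v, hv⟩
  · exact ⟨0, fun t x hx => absurd hx (hempty ▸ Set.notMem_empty x)⟩
  obtain ⟨S, hS, hSfin⟩ := Group.fg_iff.1 hG
  obtain ⟨K, hK, hKY⟩ := id hY
  have hKsub : K ⊆ oneSkeleton X := fun x hx => by
    rw [hKY]
    exact Set.mem_iUnion.2 ⟨1, x, hx, one_smul _ x⟩
  -- The elementary moves: basis elements to walk in a coset of `A`, `B`-components of generators to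
  -- change coset, and `1` for reflexivity.
  set T : Set (B ⋊[φ] A) := insert 1 (Set.range (fun i => SemidirectProduct.inr (b i)) ∪
    (fun s => SemidirectProduct.inl s.left) '' S)
  have hTfin : T.Finite := ((Set.finite_range _).union (hSfin.image _)).insert 1
  -- One constant `R` serves both the compact set `K`, whose translates cover the `1`-skeleton, and
  -- the finitely many endpoints `s • v` of moves.
  obtain ⟨R, hR⟩ := hX.exists_smul_joinedIn hY hcont hρ
    (hK.union (hTfin.image fun g : B ⋊[φ] A => g • v).isCompact)
    (Set.union_subset hKsub (Set.image_subset_iff.2 fun g _ => hY.smul_mem g hv)) hv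
    (CayleyTree.vertex b 1)
  have hgen : ∀ s ∈ T, ∀ (g : B ⋊[φ] A) (t : ℝ), CayleyTree.vertex b g.right ∈ τ.horoball t →
      JoinedIn (oneSkeleton X ∩ h ⁻¹' τ.horoball (t - R)) (g • v) ((g * s) • v) := by
    intro s hs g t hg
    rw [mul_smul]
    rw [← semidirectAction_vertex_one] at hg
    exact ((hR (s • v) (Or.inr ⟨s, hs, rfl⟩)).2 g τ t hg).symm
  have hjoin : ∀ (t : ℝ) (g g' : B ⋊[φ] A), CayleyTree.vertex b g.right ∈ τ.horoball t →
      CayleyTree.vertex b g'.right ∈ τ.horoball t →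
      JoinedIn (oneSkeleton X ∩ h ⁻¹' τ.horoball (t - 2 - R)) (g • v) (g' • v) := by
    intro t g g' hg hg'
    refine SemidirectProduct.rel_of_generators (φ := φ) hS
      (r := fun g g' => JoinedIn (oneSkeleton X ∩ h ⁻¹' τ.horoball (t - 2 - R)) (g • v) (g' • v))
      JoinedIn.symm JoinedIn.trans (H := {a | CayleyTree.vertex b a ∈ τ.horoball t})
      (fun β a ha a' ha' => ?_) (fun s hs β a ha => ?_)
      (CayleyTree.exists_mul_mem_horoball hτ hker · t) hg hg'
    · refine rel_of_mem_horoball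
        (r := fun g g' => JoinedIn (oneSkeleton X ∩ h ⁻¹' τ.horoball (t - 2 - R)) (g • v) (g' • v))
        JoinedIn.symm JoinedIn.trans hτ (fun a ha => ?_) (fun a i ha => ?_) ha ha'
      · simpa using hgen 1 (Or.inl rfl) ⟨β, a⟩ (t - 2) ha
      · exact hgen _ (Or.inr (Or.inl ⟨i, rfl⟩)) ⟨β, a⟩ (t - 2) ha
    · exact hgen _ (Or.inr (Or.inr ⟨s, hs, rfl⟩)) ⟨β, a⟩ (t - 2)
        (τ.horoball_antitone (by linarith) ha)
  have hbase : ∀ t, ∀ x ∈ oneSkeleton X, h x ∈ τ.horoball t → ∃ g : B ⋊[φ] A,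
      CayleyTree.vertex b g.right ∈ τ.horoball (t - R) ∧
        JoinedIn (oneSkeleton X ∩ h ⁻¹' τ.horoball (t - R - 2 - R)) x (g • v) := by
    intro t x hx hxt
    rw [hKY] at hx
    obtain ⟨g, k, hk, rfl⟩ := Set.mem_iUnion.1 hx
    obtain ⟨hkR, hkj⟩ := hR k (Or.inl hk)
    have hg : semidirectAction b φ g (CayleyTree.vertex b 1) ∈ τ.horoball (t - R) := by
      refine τ.mem_horoball_of_dist_le hxt ?_
      change dist _ (h (g • k)) ≤ R
      rwa [hρ g k (hKsub hk), (semidirectAction b φ g).isometry.dist_eq, dist_comm]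
    refine ⟨g, semidirectAction_vertex_one (b := b) g ▸ hg, (hkj g τ _ hg).mono ?_⟩
    exact Set.inter_subset_inter_right _ (Set.preimage_mono (τ.horoball_antitone (by linarith)))
  -- The first `R` is lost in passing from a point to a nearby `g • v`, the `2` in the edge paths
  -- over the horoball, and the last `R` in realizing each move by a path.
  refine ⟨R + 2 + R, fun t x hx hxt y hy hyt => ?_⟩
  obtain ⟨g, hg, hxg⟩ := hbase t x hx hxt
  obtain ⟨g', hg', hyg⟩ := hbase t y hy hyt
  rw [show t - (R + 2 + R) = t - R - 2 - R by ring]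
  exact (hxg.trans (hjoin _ g g' hg hg')).trans hyg.symm

end Semidirect

theorem mainTheorem3 {ι : Type u₁} [Finite ι] {A : Type u₂} [Group A] (b : FreeGroupBasis ι A)
    {B : Type u₃} [Group B] (φ : A →* MulAut B) (hG : Group.FG (B ⋊[φ] A))
    (c : ℕ → ι × Bool) (hc : IsReducedWord c)
    (hker : {p : ℕ × ℕ | p.1 < p.2 ∧ subwordVal b c p.1 p.2 ∈ φ.ker}.Infinite)
    (e : Boundary (CayleyTree b)) (he : IsEndpointOfWord b c e) :
    e ∈ SigmaOne.{max u₂ u₃, u₂, u₄} (semidirectAction b φ) := by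
  obtain ⟨τ', hτ', rfl⟩ := he
  intro X _ _ _ _ _ hX hY h hcont hρ τ hτ
  obtain ⟨D, hD⟩ := hX.exists_dist_le_of_mem_closedCell hY hcont hρ
  obtain ⟨L, hL⟩ := exists_forall_joinedIn_horoball hG hτ'
    (exists_large_subwordVal_mem b c hker) hX hY hcont hρ
  exact IsControlledConnected.of_forall_joinedIn hD hτ hL
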